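/- Let $n\ge 1$, $\rho>0$, $\alpha>0$, and let $\Sigma_R\in\mathbb{C}^{n\times n}$ be Hermitian positive definite with pairwise distinct eigenvalues. Let $\Sigma_R=V_R\,\mathrm{diag}(\eta_1,\dots,\eta_n)\,V_R^\dagger$ be an eigendecomposition with $V_R$ unitary, and let $\Sigma_E=\alpha I$. Let $h_R\sim\mathcal{CN}(0,\Sigma_R)$, $h_E\sim\mathcal{CN}(0,\Sigma_E)$ and $h_w\sim\mathcal{CN}(0,I)$ be circularly symmetric complex Gaussian vectors in $\mathbb{C}^n$. Put $\Omega=\{Q\in\mathbb{C}^{n\times n}: Q\succeq 0,\ \mathrm{Tr}(Q)=1\}$ and define the ergodic secrecy rate, for $Q\in\Omega$, by $$C_s(Q)=\mathbb{E}\log(1+\rho\, h_R^\dagger Q h_R)-\mathbb{E}\log(1+\rho\, h_E^\dagger Q h_E).$$ Call $Q\in\Omega$ optimal if it maximizes $C_s$ over $\Omega$. Let $\Delta=\{\zeta\in\mathbb{R}^n:\zeta_i\ge 0,\ \sum_i\zeta_i=1\}$ and, for $\zeta\in\Delta$, let $$R(\zeta)=\mathbb{E}\log\Bigl(1+\rho\sum_{i=1}^n\eta_i\zeta_i|h_{w,i}|^2\Bigr)-\mathbb{E}\log\Bigl(1+\alpha\rho\sum_{i=1}^n\zeta_i|h_{w,i}|^2\Bigr).$$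 Then all these expectations are finite, and the following hold. (i) For every optimal $Q$, the matrix $V_R^\dagger Q V_R$ is diagonal, i.e. $Q$ is diagonalized by the eigenvectors of $\Sigma_R$. (ii) The problem reduces to a power allocation over the eigenvalues of $\Sigma_R$. For every $\zeta\in\Delta$ one has $V_R\,\mathrm{diag}(\zeta)V_R^\dagger\in\Omega$ and $C_s(V_R\,\mathrm{diag}(\zeta)V_R^\dagger)=R(\zeta)$. A matrix $Q$ is optimal if and only if $Q=V_R\,\mathrm{diag}(\zeta)V_R^\dagger$ for some $\zeta$ maximizing $R$ over $\Delta$. Both maxima are attained, and $\max_{Q\in\Omega}C_s(Q)=\max_{\zeta\in\Delta}R(\zeta)$. -/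

import Mathlib

open MeasureTheory ProbabilityTheory
open scoped Matrix MatrixOrder ComplexOrder NNReal

noncomputable section

namespace MISOWiretap

/-- The law `CN(0, 1)`: real and imaginary parts are independent `N(0, 1/2)` variables. -/
def stdComplexGaussian : Measure ℂ :=
  ((gaussianReal 0 (1 / 2 : ℝ≥0)).prod (gaussianReal 0 (1 / 2 : ℝ≥0))).map
    Complex.measurableEquivRealProd.symm

/-- The law `CN(0, I)` on `ℂⁿ`: the entries are independent `CN(0, 1)` variables. -/
def stdComplexGaussianVec (n : ℕ) : Measure (Fin n → ℂ) :=
  Measure.pi fun _ => stdComplexGaussian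

/-- The circularly symmetric complex Gaussian law `CN(0, S)` with covariance matrix `S` (positive
semidefinite): the law of `S ^ (1/2) * w`, where `w` has law `CN(0, I)` and `S ^ (1/2)` is the
positive semidefinite square root. -/
def complexGaussian {n : ℕ} (S : Matrix (Fin n) (Fin n) ℂ) : Measure (Fin n → ℂ) :=
  (stdComplexGaussianVec n).map fun w => CFC.sqrt S *ᵥ w

/-- `log (1 + ρ h† Q h)`; the quadratic form is real whenever `Q` is Hermitian. -/
def logRate {n : ℕ} (ρ : ℝ) (Q : Matrix (Fin n) (Fin n) ℂ) (h : Fin n → ℂ) : ℝ :=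
  Real.log (1 + ρ * (star h ⬝ᵥ Q *ᵥ h).re)

/-- The ergodic secrecy rate
`C_s(Q) = E log (1 + ρ h_R† Q h_R) - E log (1 + ρ h_E† Q h_E)`, where `h_R` has law `CN(0, SR)`
and `h_E` has law `CN(0, SE)`. -/
def ergodicSecrecyRate {n : ℕ} (ρ : ℝ) (SR SE Q : Matrix (Fin n) (Fin n) ℂ) : ℝ :=
  (∫ h, logRate ρ Q h ∂(complexGaussian SR)) - ∫ h, logRate ρ Q h ∂(complexGaussian SE)

/-- The feasible set of normalized input covariances. -/
def feasibleSet (n : ℕ) : Set (Matrix (Fin n) (Fin n) ℂ) :=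
  {Q | Q.PosSemidef ∧ Q.trace = 1}

/-- `Q` is an optimal input covariance: it maximizes the ergodic secrecy rate over the feasible
set. -/
def IsOptimalInput {n : ℕ} (ρ : ℝ) (SR SE Q : Matrix (Fin n) (Fin n) ℂ) : Prop :=
  Q ∈ feasibleSet n ∧ IsMaxOn (ergodicSecrecyRate ρ SR SE) (feasibleSet n) Q

/-- `log (1 + ρ ∑ i, c i * |w i| ^ 2)`. -/
def logAllocRate {n : ℕ} (ρ : ℝ) (c : Fin n → ℝ) (w : Fin n → ℂ) : ℝ :=
  Real.log (1 + ρ * ∑ i, c i * ‖w i‖ ^ 2)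

/-- The objective of the power allocation problem,
`E log (1 + ρ ∑ i, η i ζ i |w i| ^ 2) - E log (1 + α ρ ∑ i, ζ i |w i| ^ 2)`, where `w` has law
`CN(0, I)`. -/
def allocationRate {n : ℕ} (ρ α : ℝ) (η ζ : Fin n → ℝ) : ℝ :=
  (∫ w, logAllocRate ρ (fun i => η i * ζ i) w ∂(stdComplexGaussianVec n)) -
    ∫ w, logAllocRate (α * ρ) ζ w ∂(stdComplexGaussianVec n)

/-- `ζ` is an optimal power allocation: it maximizes `allocationRate` over all `ζ ≥ 0` with
`∑ i, ζ i = 1`. -/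
def IsOptimalAllocation {n : ℕ} (ρ α : ℝ) (η ζ : Fin n → ℝ) : Prop :=
  ζ ∈ stdSimplex ℝ (Fin n) ∧ IsMaxOn (allocationRate ρ α η) (stdSimplex ℝ (Fin n)) ζ

/-- The matrix `V diag(c) V†` for a real vector `c`. -/
def conjDiag {n : ℕ} (V : Matrix (Fin n) (Fin n) ℂ) (c : Fin n → ℝ) :
    Matrix (Fin n) (Fin n) ℂ :=
  V * Matrix.diagonal (fun i => (c i : ℂ)) * Vᴴ

end MISOWiretap

end

/-! The law CN(0, I) is unitarily invariant, so with `SE = α • 1` the eavesdropper's term depends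
only on the spectrum of `Q`. An optimal `Q` therefore maximizes the legitimate term over its own
unitary orbit. In the eigenbasis put A = V†QV, S = diag(√η), W = SAS, and let M be the gradient of
the ergodic rate at W.

Stationarity along unitary curves through the identity makes SMSA Hermitian
(`im_eq_zero_of_forall_unitary_le`), so SMS commutes with A, and hence S²(MW) = (WM)S². By
equivariance, M is diagonal in any eigenbasis U of W (`rateGradient_conjDiag`). Thus MW = WM = U
diag(cᵢeᵢ) U†, which commutes with S² = diag(η). As the ηᵢ are distinct, MW is diagonal.

To pass from MW back to W, cᵢ must be determined by cᵢeᵢ. This holds because cᵢ > cⱼ implies cᵢeᵢ >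
cⱼeⱼ (`mul_rateGradient_diagonal_lt`), an exchange argument on two coordinates. So W is diagonal,
and A with it.

Compactness of the feasible set and dominated convergence give an optimal `Q`. Being diagonalized by
V, it turns the matrix problem into the power allocation. -/

namespace MISOWiretap

open Matrix

variable {n : ℕ}

/-! ### Invariance and moments of CN(0, I). -/

section StandardGaussian

instance : IsProbabilityMeasure stdComplexGaussian :=
  Measure.isProbabilityMeasure_map (MeasurableEquiv.measurable _).aemeasurable

instance : IsProbabilityMeasure (stdComplexGaussianVec n) := by
  unfold stdComplexGaussianVec
  infer_instance

/-- Only `‖z‖` enters, which is the source of unitary invariance. The 1/4 is the Gaussian factor 1/2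
times the variance 1/2 of each real coordinate. -/
theorem charFun_stdComplexGaussian (z : ℂ) :
    charFun stdComplexGaussian z = Complex.exp (-(‖z‖ ^ 2 / 4 : ℝ)) := by
  have key : ∀ p : ℝ × ℝ,
      Complex.exp ((inner ℝ (Complex.measurableEquivRealProd.symm p) z : ℝ) * Complex.I) =
        Complex.exp (z.re * p.1 * Complex.I) * Complex.exp (z.im * p.2 * Complex.I) := by
    intro p
    rw [← Complex.exp_add]
    congr 1
    simp [Complex.inner, Complex.measurableEquivRealProd_symm_apply]
    ring
  rw [charFun_apply, stdComplexGaussian, integral_map_equiv]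
  simp_rw [key]
  rw [integral_prod_mul (fun x : ℝ => Complex.exp (z.re * x * Complex.I))
    (fun x : ℝ => Complex.exp (z.im * x * Complex.I)), ← charFun_apply_real, ← charFun_apply_real,
    charFun_gaussianReal, charFun_gaussianReal, ← Complex.exp_add]
  congr 1
  rw [Complex.sq_norm, Complex.normSq_apply]
  push_cast
  ring

/-- Compare characteristic functions: Re⟨Uw, t⟩ = Re⟨w, U†t⟩, the characteristic function of CN(0,
I) depends only on the norm of its argument, and U† preserves that norm. -/
theorem measurePreserving_unitary {U : Matrix (Fin n) (Fin n) ℂ}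
    (hU : U ∈ unitaryGroup (Fin n) ℂ) :
    MeasurePreserving (fun w : Fin n → ℂ => U *ᵥ w) (stdComplexGaussianVec n)
      (stdComplexGaussianVec n) := by
  have hcont : Continuous fun w : Fin n → ℂ => U *ᵥ w := by fun_prop
  refine ⟨hcont.measurable, ?_⟩
  have := Measure.isProbabilityMeasure_map (μ := stdComplexGaussianVec n)
    hcont.measurable.aemeasurable
  conv_rhs => rw [stdComplexGaussianVec]
  rw [← charFun_eq_pi_iff]
  intro t
  have hnorm : ∑ i, ‖(Uᴴ *ᵥ t.ofLp) i‖ ^ 2 = ∑ i, ‖t i‖ ^ 2 := by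
    have h1 : ∀ x : Fin n → ℂ, ((∑ i, ‖x i‖ ^ 2 : ℝ) : ℂ) = star x ⬝ᵥ x := by
      intro x
      simp [dotProduct, Complex.conj_mul']
    have h2 : star (Uᴴ *ᵥ t.ofLp) ⬝ᵥ (Uᴴ *ᵥ t.ofLp) = star t.ofLp ⬝ᵥ t.ofLp := by
      rw [star_mulVec, conjTranspose_conjTranspose, ← dotProduct_mulVec, mulVec_mulVec,
        ← star_eq_conjTranspose, mem_unitaryGroup_iff.1 hU, one_mulVec]
    rw [← h1, ← h1] at h2
    exact_mod_cast h2
  have h3 : charFun (((stdComplexGaussianVec n).map fun w => U *ᵥ w).map (WithLp.toLp 2)) t =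
      charFun ((stdComplexGaussianVec n).map (WithLp.toLp 2)) (WithLp.toLp 2 (Uᴴ *ᵥ t.ofLp)) := by
    rw [charFun_apply, charFun_apply, integral_map, integral_map, integral_map]
    · congr with w
      congr 3
      have h4 : ∀ x y : Fin n → ℂ, inner ℝ (WithLp.toLp 2 x : PiLp 2 fun _ : Fin n => ℂ)
          (WithLp.toLp 2 y) = (star x ⬝ᵥ y).re := by
        intro x y
        simp [PiLp.inner_apply, dotProduct, Complex.inner, mul_comm]
      rw [h4, show t = WithLp.toLp 2 t.ofLp from rfl, h4]
      rw [star_mulVec, ← dotProduct_mulVec]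
    all_goals fun_prop
  rw [h3, stdComplexGaussianVec, charFun_pi]
  simp_rw [charFun_stdComplexGaussian]
  rw [← Complex.exp_sum, ← Complex.exp_sum]
  congr 1
  rw [Finset.sum_neg_distrib, Finset.sum_neg_distrib]
  rw [← Complex.ofReal_sum, ← Complex.ofReal_sum, ← Finset.sum_div, ← Finset.sum_div]
  rw [hnorm]

theorem integrable_norm_sq_stdComplexGaussian :
    Integrable (fun z : ℂ => ‖z‖ ^ 2) stdComplexGaussian := by
  have h : Integrable (fun x : ℝ => x ^ 2) (gaussianReal 0 (1 / 2 : ℝ≥0)) :=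
    (memLp_id_gaussianReal 2).integrable_sq
  rw [stdComplexGaussian, integrable_map_equiv]
  refine ((h.comp_fst _).add (h.comp_snd _)).congr (.of_forall fun p => ?_)
  simp only [Function.comp_apply, Complex.measurableEquivRealProd_symm_apply, Complex.sq_norm,
    Complex.normSq_apply, Pi.add_apply]
  ring

theorem stdComplexGaussian_singleton_zero : stdComplexGaussian {0} = 0 := by
  rw [stdComplexGaussian, MeasurableEquiv.map_apply]
  refine measure_mono_null (t := ({0} : Set ℝ) ×ˢ Set.univ) ?_ ?_
  · rintro p hp
    simp only [Set.mem_preimage, Set.mem_singleton_iff] at hp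
    have := congrArg Complex.re hp
    simpa [Complex.measurableEquivRealProd_symm_apply] using this
  · have := nullSingletonClass_gaussianReal (μ := 0) (v := (1 / 2 : ℝ≥0)) (by norm_num)
    rw [Measure.prod_prod, measure_singleton, zero_mul]

theorem integrable_norm_sq_apply (i : Fin n) :
    Integrable (fun w : Fin n → ℂ => ‖w i‖ ^ 2) (stdComplexGaussianVec n) :=
  (measurePreserving_eval (fun _ : Fin n => stdComplexGaussian) i).integrable_comp_of_integrable
    integrable_norm_sq_stdComplexGaussian

/-- Supplies the strictness in the exchange argument of `mul_rateGradient_diagonal_lt`. -/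
theorem ae_apply_ne_zero (i : Fin n) : ∀ᵐ w ∂stdComplexGaussianVec n, w i ≠ 0 :=
  (measurePreserving_eval (fun _ : Fin n => stdComplexGaussian) i).quasiMeasurePreserving.ae
    (p := fun z => z ≠ 0) (by simpa [ae_iff] using stdComplexGaussian_singleton_zero)

theorem integrable_sum_norm_sq :
    Integrable (fun w : Fin n → ℂ => ∑ i, ‖w i‖ ^ 2) (stdComplexGaussianVec n) :=
  integrable_finsetSum _ fun i _ => integrable_norm_sq_apply i

theorem measurePreserving_comp_equiv (σ : Equiv.Perm (Fin n)) :
    MeasurePreserving (fun (w : Fin n → ℂ) i => w (σ i)) (stdComplexGaussianVec n)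
      (stdComplexGaussianVec n) := by
  have := measurePreserving_piCongrLeft (fun _ : Fin n => stdComplexGaussian) σ.symm
  rw [stdComplexGaussianVec]
  convert this using 1
  funext w i
  have h := Equiv.piCongrLeft_apply_apply (fun _ : Fin n => ℂ) σ.symm w (σ i)
  rw [Equiv.symm_apply_apply] at h
  exact h.symm

end StandardGaussian

/-! ### Quadratic forms and their bounds. -/

section QuadraticForm

/-- The real part of the quadratic form `w† Q w`. -/
def quadForm (Q : Matrix (Fin n) (Fin n) ℂ) (w : Fin n → ℂ) : ℝ := (star w ⬝ᵥ Q *ᵥ w).re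

theorem logRate_eq (ρ : ℝ) (Q : Matrix (Fin n) (Fin n) ℂ) (w : Fin n → ℂ) :
    logRate ρ Q w = Real.log (1 + ρ * quadForm Q w) := rfl

theorem continuous_quadForm_right (Q : Matrix (Fin n) (Fin n) ℂ) : Continuous (quadForm Q) := by
  unfold quadForm
  fun_prop

theorem continuous_quadForm_left (w : Fin n → ℂ) :
    Continuous fun Q : Matrix (Fin n) (Fin n) ℂ => quadForm Q w := by
  unfold quadForm
  fun_prop

theorem quadForm_nonneg {Q : Matrix (Fin n) (Fin n) ℂ} (hQ : Q.PosSemidef) (w : Fin n → ℂ) :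
    0 ≤ quadForm Q w :=
  (Complex.le_def.1 (hQ.dotProduct_mulVec_nonneg w)).1

theorem quadForm_mulVec (Q B : Matrix (Fin n) (Fin n) ℂ) (w : Fin n → ℂ) :
    quadForm Q (B *ᵥ w) = quadForm (Bᴴ * Q * B) w := by
  rw [quadForm, quadForm, star_mulVec, ← dotProduct_mulVec, mulVec_mulVec, mulVec_mulVec,
    Matrix.mul_assoc]

theorem norm_mul_norm_le_sum_sq (w : Fin n → ℂ) (i j : Fin n) :
    ‖w i‖ * ‖w j‖ ≤ ∑ k, ‖w k‖ ^ 2 := by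
  have h : ∀ i, ‖w i‖ ^ 2 ≤ ∑ k, ‖w k‖ ^ 2 := fun i =>
    Finset.single_le_sum (f := fun k => ‖w k‖ ^ 2) (fun k _ => sq_nonneg _) (Finset.mem_univ i)
  nlinarith [h i, h j, sq_nonneg (‖w i‖ - ‖w j‖)]

/-- A crude bound suffices: its constant is continuous in `Q`, so it gives a dominating function
that is locally uniform in `Q`. -/
theorem norm_dotProduct_mulVec_le (Q : Matrix (Fin n) (Fin n) ℂ) (w : Fin n → ℂ) :
    ‖star w ⬝ᵥ Q *ᵥ w‖ ≤ (∑ i, ∑ j, ‖Q i j‖) * ∑ k, ‖w k‖ ^ 2 := by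
  simp only [dotProduct, mulVec, Finset.mul_sum, Pi.star_apply]
  rw [← Finset.mul_sum, Finset.sum_mul]
  refine (norm_sum_le _ _).trans (Finset.sum_le_sum fun i _ => ?_)
  rw [Finset.sum_mul]
  refine (norm_sum_le _ _).trans (Finset.sum_le_sum fun j _ => ?_)
  rw [norm_mul, norm_mul, norm_star]
  calc ‖w i‖ * (‖Q i j‖ * ‖w j‖) = ‖Q i j‖ * (‖w i‖ * ‖w j‖) := by ring
    _ ≤ _ := mul_le_mul_of_nonneg_left (norm_mul_norm_le_sum_sq w i j) (norm_nonneg _)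

theorem quadForm_le (Q : Matrix (Fin n) (Fin n) ℂ) (w : Fin n → ℂ) :
    quadForm Q w ≤ (∑ i, ∑ j, ‖Q i j‖) * ∑ k, ‖w k‖ ^ 2 :=
  (Complex.re_le_norm _).trans (norm_dotProduct_mulVec_le Q w)

theorem quadForm_diagonal (c : Fin n → ℝ) (w : Fin n → ℂ) :
    quadForm (diagonal fun i => (c i : ℂ)) w = ∑ i, c i * ‖w i‖ ^ 2 := by
  rw [quadForm, dotProduct, Complex.re_sum]
  refine Finset.sum_congr rfl fun i _ => ?_
  rw [mulVec_diagonal, Complex.sq_norm, Complex.normSq_apply]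
  simp
  ring

end QuadraticForm

/-! ### Integrability, unitary invariance and continuity of the ergodic rate. -/

section Rate

theorem norm_log_one_add_le {x : ℝ} (hx : 0 ≤ x) : ‖Real.log (1 + x)‖ ≤ x := by
  rw [Real.norm_of_nonneg (Real.log_nonneg (by linarith))]
  linarith [Real.log_le_sub_one_of_pos (show 0 < 1 + x by linarith)]

theorem measurable_logRate (ρ : ℝ) (Q : Matrix (Fin n) (Fin n) ℂ) : Measurable (logRate ρ Q) :=
  Real.measurable_log.comp
    (((continuous_quadForm_right Q).measurable.const_mul ρ).const_add 1)

theorem norm_logRate_le {ρ : ℝ} (hρ : 0 ≤ ρ) {Q : Matrix (Fin n) (Fin n) ℂ} (hQ : Q.PosSemidef)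
    (w : Fin n → ℂ) : ‖logRate ρ Q w‖ ≤ ρ * ((∑ i, ∑ j, ‖Q i j‖) * ∑ k, ‖w k‖ ^ 2) :=
  (norm_log_one_add_le (mul_nonneg hρ (quadForm_nonneg hQ w))).trans
    (mul_le_mul_of_nonneg_left (quadForm_le Q w) hρ)

theorem integrable_logRate {ρ : ℝ} (hρ : 0 ≤ ρ) {Q : Matrix (Fin n) (Fin n) ℂ}
    (hQ : Q.PosSemidef) : Integrable (logRate ρ Q) (stdComplexGaussianVec n) :=
  ((integrable_sum_norm_sq.const_mul _).const_mul ρ).mono'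
    (measurable_logRate ρ Q).aestronglyMeasurable (.of_forall (norm_logRate_le hρ hQ))

theorem logRate_diagonal (ρ : ℝ) (c : Fin n → ℝ) :
    logRate ρ (diagonal fun i => (c i : ℂ)) = logAllocRate ρ c := by
  funext w
  rw [logRate_eq, quadForm_diagonal, logAllocRate]

theorem logRate_mulVec (ρ : ℝ) (Q B : Matrix (Fin n) (Fin n) ℂ) (w : Fin n → ℂ) :
    logRate ρ Q (B *ᵥ w) = logRate ρ (Bᴴ * Q * B) w := by
  rw [logRate_eq, logRate_eq, quadForm_mulVec]

/-- The ergodic rate `E log (1 + ρ w† Q w)` for `w` of law `CN(0, I)`. -/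
noncomputable def stdRate (ρ : ℝ) (Q : Matrix (Fin n) (Fin n) ℂ) : ℝ :=
  ∫ w, logRate ρ Q w ∂stdComplexGaussianVec n

theorem stdRate_unitary (ρ : ℝ) (Q : Matrix (Fin n) (Fin n) ℂ) {U : Matrix (Fin n) (Fin n) ℂ}
    (hU : U ∈ unitaryGroup (Fin n) ℂ) : stdRate ρ (Uᴴ * Q * U) = stdRate ρ Q := by
  rw [stdRate, stdRate]
  simp_rw [← logRate_mulVec]
  conv_rhs => rw [← (measurePreserving_unitary hU).map_eq]
  rw [integral_map]
  · exact (measurePreserving_unitary hU).measurable.aemeasurable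
  · exact (measurable_logRate ρ Q).aestronglyMeasurable

theorem continuousOn_stdRate {ρ : ℝ} (hρ : 0 ≤ ρ) :
    ContinuousOn (stdRate ρ) {Q : Matrix (Fin n) (Fin n) ℂ | Q.PosSemidef} := by
  intro Q₀ hQ₀
  have : FirstCountableTopology (Matrix (Fin n) (Fin n) ℂ) :=
    inferInstanceAs (FirstCountableTopology (Fin n → Fin n → ℂ))
  have hsum : Continuous fun Q : Matrix (Fin n) (Fin n) ℂ => ∑ i, ∑ j, ‖Q i j‖ := by fun_prop
  -- The slack 1 yields one integrable dominating function for all `Q` near `Q₀`.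
  have hev : ∀ᶠ Q in nhdsWithin Q₀ {Q : Matrix (Fin n) (Fin n) ℂ | Q.PosSemidef},
      ∑ i, ∑ j, ‖Q i j‖ < (∑ i, ∑ j, ‖Q₀ i j‖) + 1 :=
    (hsum.continuousWithinAt.tendsto).eventually_lt_const (by linarith)
  refine continuousWithinAt_of_dominated
    (bound := fun w => ρ * (((∑ i, ∑ j, ‖Q₀ i j‖) + 1) * ∑ k, ‖w k‖ ^ 2)) ?_ ?_ ?_ ?_
  · exact .of_forall fun Q => (measurable_logRate ρ Q).aestronglyMeasurable
  · filter_upwards [hev, self_mem_nhdsWithin] with Q h1 h2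
    refine .of_forall fun w => (norm_logRate_le hρ h2 w).trans ?_
    gcongr
  · exact (integrable_sum_norm_sq.const_mul _).const_mul ρ
  · refine .of_forall fun w => ContinuousAt.continuousWithinAt ?_
    refine ContinuousAt.log ?_ ?_
    · exact ((continuous_quadForm_left w).continuousAt.const_mul ρ).const_add 1
    · have := mul_nonneg hρ (quadForm_nonneg hQ₀ w)
      rw [quadForm] at this
      linarith

end Rate

/-! ### Reduction of general covariances to CN(0, I). -/

section Covariance

theorem isHermitian_sqrt (S : Matrix (Fin n) (Fin n) ℂ) : (CFC.sqrt S)ᴴ = CFC.sqrt S :=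
  (nonneg_iff_posSemidef.1 (CFC.sqrt_nonneg S)).isHermitian

theorem measurable_mulVec (B : Matrix (Fin n) (Fin n) ℂ) :
    Measurable fun w : Fin n → ℂ => B *ᵥ w :=
  Continuous.measurable (by fun_prop)

theorem integral_logRate_complexGaussian (ρ : ℝ) (S Q : Matrix (Fin n) (Fin n) ℂ) :
    ∫ h, logRate ρ Q h ∂complexGaussian S = stdRate ρ (CFC.sqrt S * Q * CFC.sqrt S) := by
  rw [complexGaussian, integral_map (measurable_mulVec _).aemeasurable
    (measurable_logRate ρ Q).aestronglyMeasurable]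
  simp_rw [logRate_mulVec, isHermitian_sqrt]
  rfl

theorem integrable_logRate_complexGaussian {ρ : ℝ} (hρ : 0 ≤ ρ) (S : Matrix (Fin n) (Fin n) ℂ)
    {Q : Matrix (Fin n) (Fin n) ℂ} (hQ : Q.PosSemidef) :
    Integrable (logRate ρ Q) (complexGaussian S) := by
  rw [complexGaussian, integrable_map_measure (measurable_logRate ρ Q).aestronglyMeasurable
    (measurable_mulVec _).aemeasurable]
  have h := integrable_logRate hρ (hQ.conjTranspose_mul_mul_same (CFC.sqrt S))
  exact h.congr (.of_forall fun w => (logRate_mulVec ρ Q _ w).symm)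

theorem posSemidef_diagonal_ofReal {c : Fin n → ℝ} (hc : ∀ i, 0 ≤ c i) :
    (diagonal fun i => (c i : ℂ)).PosSemidef :=
  .diagonal fun i => by simpa using hc i

theorem posSemidef_conjDiag (V : Matrix (Fin n) (Fin n) ℂ) {c : Fin n → ℝ} (hc : ∀ i, 0 ≤ c i) :
    (conjDiag V c).PosSemidef :=
  (posSemidef_diagonal_ofReal hc).mul_mul_conjTranspose_same V

theorem conjDiag_mul_conjDiag {V : Matrix (Fin n) (Fin n) ℂ} (hV : V ∈ unitaryGroup (Fin n) ℂ)
    (c d : Fin n → ℝ) : conjDiag V c * conjDiag V d = conjDiag V fun i => c i * d i := by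
  have h : Vᴴ * V = 1 := mem_unitaryGroup_iff'.1 hV
  calc conjDiag V c * conjDiag V d
      = V * (diagonal fun i => (c i : ℂ)) * (Vᴴ * V) * (diagonal fun i => (d i : ℂ)) * Vᴴ := by
        simp only [conjDiag, Matrix.mul_assoc]
    _ = _ := by
        rw [h, Matrix.mul_one, Matrix.mul_assoc V, diagonal_mul_diagonal, conjDiag]
        simp

theorem sqrt_conjDiag {V : Matrix (Fin n) (Fin n) ℂ} (hV : V ∈ unitaryGroup (Fin n) ℂ)
    {c : Fin n → ℝ} (hc : ∀ i, 0 ≤ c i) :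
    CFC.sqrt (conjDiag V c) = conjDiag V fun i => √(c i) := by
  refine CFC.sqrt_unique ?_
    (nonneg_iff_posSemidef.2 (posSemidef_conjDiag V fun i => Real.sqrt_nonneg _))
  rw [conjDiag_mul_conjDiag hV]
  simp_rw [Real.mul_self_sqrt (hc _)]

theorem sqrt_smul_one {α : ℝ} (hα : 0 ≤ α) :
    CFC.sqrt ((α : ℂ) • (1 : Matrix (Fin n) (Fin n) ℂ)) = ((√α : ℝ) : ℂ) • 1 := by
  refine CFC.sqrt_unique ?_ (nonneg_iff_posSemidef.2 ?_)
  · rw [smul_mul_smul_comm, mul_one, ← Complex.ofReal_mul, Real.mul_self_sqrt hα]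
  · exact PosSemidef.one.smul (by simp)

/-- An isotropic covariance only rescales the signal-to-noise ratio. -/
theorem stdRate_sqrt_smul_one (ρ : ℝ) {α : ℝ} (hα : 0 ≤ α) (Q : Matrix (Fin n) (Fin n) ℂ) :
    stdRate ρ (((√α : ℝ) : ℂ) • (1 : Matrix (Fin n) (Fin n) ℂ) * Q * ((√α : ℝ) : ℂ) • 1) =
      stdRate (α * ρ) Q := by
  have h : ((√α : ℝ) : ℂ) • (1 : Matrix (Fin n) (Fin n) ℂ) * Q * ((√α : ℝ) : ℂ) • 1 =
      (α : ℂ) • Q := by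
    rw [smul_mul_assoc, one_mul, smul_mul_smul_comm, mul_one, ← Complex.ofReal_mul,
      Real.mul_self_sqrt hα]
  rw [h, stdRate, stdRate]
  congr with w
  rw [logRate_eq, logRate_eq, quadForm, quadForm, smul_mulVec, dotProduct_smul, smul_eq_mul,
    Complex.re_ofReal_mul]
  ring_nf

/-- The secrecy rate in the eigenbasis of the covariance matrix of the legitimate channel. -/
theorem ergodicSecrecyRate_eq (ρ : ℝ) {α : ℝ} (hα : 0 ≤ α) {V : Matrix (Fin n) (Fin n) ℂ}
    (hV : V ∈ unitaryGroup (Fin n) ℂ) {η : Fin n → ℝ} (hη : ∀ i, 0 ≤ η i)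
    (Q : Matrix (Fin n) (Fin n) ℂ) :
    ergodicSecrecyRate ρ (conjDiag V η) ((α : ℂ) • 1) Q =
      stdRate ρ ((diagonal fun i => ((√(η i) : ℝ) : ℂ)) * (Vᴴ * Q * V) *
        diagonal fun i => ((√(η i) : ℝ) : ℂ)) - stdRate (α * ρ) Q := by
  rw [ergodicSecrecyRate, integral_logRate_complexGaussian, integral_logRate_complexGaussian,
    sqrt_conjDiag hV hη, sqrt_smul_one hα, stdRate_sqrt_smul_one ρ hα]
  congr 1
  -- Only the first term is conjugated by `V`; the inner products V†V then cancel.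
  rw [← stdRate_unitary ρ _ hV]
  congr 1
  have h : Vᴴ * V = 1 := mem_unitaryGroup_iff'.1 hV
  simp only [conjDiag, Matrix.mul_assoc, h, Matrix.mul_one]
  simp only [← Matrix.mul_assoc, h, Matrix.one_mul]

end Covariance

/-! ### Compactness of the feasible set. -/

section Feasible

theorem mem_feasibleSet_unitary {Q U : Matrix (Fin n) (Fin n) ℂ} (hQ : Q ∈ feasibleSet n)
    (hU : U ∈ unitaryGroup (Fin n) ℂ) : U * Q * Uᴴ ∈ feasibleSet n := by
  refine ⟨hQ.1.mul_mul_conjTranspose_same U, ?_⟩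
  rw [trace_mul_comm, ← Matrix.mul_assoc, show Uᴴ * U = 1 from mem_unitaryGroup_iff'.1 hU,
    Matrix.one_mul, hQ.2]

theorem conjDiag_mem_feasibleSet {V : Matrix (Fin n) (Fin n) ℂ} (hV : V ∈ unitaryGroup (Fin n) ℂ)
    {ζ : Fin n → ℝ} (hζ : ζ ∈ stdSimplex ℝ (Fin n)) : conjDiag V ζ ∈ feasibleSet n := by
  refine mem_feasibleSet_unitary ⟨posSemidef_diagonal_ofReal hζ.1, ?_⟩ hV
  rw [trace_diagonal, ← Complex.ofReal_sum, hζ.2, Complex.ofReal_one]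

/-- Write Q = B†B. The trace is the sum of all |Bᵢⱼ|², so the entries of B are at most 1 in modulus,
and an entry of Q is a sum of n products of them. -/
theorem norm_apply_le_of_mem_feasibleSet {Q : Matrix (Fin n) (Fin n) ℂ} (hQ : Q ∈ feasibleSet n)
    (i j : Fin n) : ‖Q i j‖ ≤ n := by
  obtain ⟨B, rfl⟩ := CStarAlgebra.nonneg_iff_eq_star_mul_self.1 (nonneg_iff_posSemidef.2 hQ.1)
  have htr : ∑ j, ∑ i, ‖B i j‖ ^ 2 = 1 := by
    have h := hQ.2
    simp only [trace, diag, mul_apply, star_apply, RCLike.star_def, Complex.conj_mul'] at h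
    exact_mod_cast h
  have hB : ∀ i j, ‖B i j‖ ≤ 1 := by
    intro i j
    have h1 : ‖B i j‖ ^ 2 ≤ ∑ i, ‖B i j‖ ^ 2 :=
      Finset.single_le_sum (f := fun i => ‖B i j‖ ^ 2) (fun k _ => sq_nonneg _) (Finset.mem_univ i)
    have h2 : ∑ i, ‖B i j‖ ^ 2 ≤ ∑ j, ∑ i, ‖B i j‖ ^ 2 :=
      Finset.single_le_sum (f := fun j => ∑ i, ‖B i j‖ ^ 2)
        (fun k _ => Finset.sum_nonneg fun i _ => sq_nonneg _) (Finset.mem_univ j)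
    exact (sq_le_one_iff₀ (norm_nonneg _)).1 (h1.trans (h2.trans htr.le))
  rw [mul_apply]
  refine (norm_sum_le_of_le _ (f := fun k => star B i k * B k j) (n := fun _ => 1)
    fun k _ => ?_).trans (by simp)
  rw [norm_mul, star_apply, norm_star]
  exact mul_le_one₀ (hB _ _) (norm_nonneg _) (hB _ _)

theorem isCompact_feasibleSet : IsCompact (feasibleSet n) := by
  have hclosed : IsClosed (feasibleSet n) := by
    have h : feasibleSet n = {Q | Qᴴ = Q} ∩
        (⋂ x : Fin n → ℂ, {Q | 0 ≤ star x ⬝ᵥ Q *ᵥ x}) ∩ {Q | Q.trace = 1} := by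
      ext Q
      simp [feasibleSet, posSemidef_iff_dotProduct_mulVec, IsHermitian]
    rw [h]
    refine ((isClosed_eq (by fun_prop) (by fun_prop)).inter
      (isClosed_iInter fun x => isClosed_le continuous_const (by fun_prop))).inter
      (isClosed_eq (by fun_prop) (by fun_prop))
  refine IsCompact.of_isClosed_subset (s := Set.univ.pi fun _ => Set.univ.pi fun _ =>
    Metric.closedBall (0 : ℂ) n) (isCompact_univ_pi fun _ => isCompact_univ_pi fun _ =>
      isCompact_closedBall _ _) hclosed ?_
  intro Q hQ i _ j _
  simpa using norm_apply_le_of_mem_feasibleSet hQ i j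

end Feasible

/-! ### The gradient of the ergodic rate and its symmetries. -/

section Gradient

/-- The weight `ρ / (1 + ρ w† W w)` in the derivative of the ergodic rate. -/
noncomputable def rateWeight (ρ : ℝ) (W : Matrix (Fin n) (Fin n) ℂ) (w : Fin n → ℂ) : ℝ :=
  ρ / (1 + ρ * quadForm W w)

/-- The gradient `E [ρ w w† / (1 + ρ w† W w)]` of the ergodic rate. -/
noncomputable def rateGradient (ρ : ℝ) (W : Matrix (Fin n) (Fin n) ℂ) :
    Matrix (Fin n) (Fin n) ℂ :=
  of fun i j => ∫ w, (w i * star (w j)) * (rateWeight ρ W w : ℂ) ∂stdComplexGaussianVec n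

theorem measurable_rateWeight (ρ : ℝ) (W : Matrix (Fin n) (Fin n) ℂ) :
    Measurable (rateWeight ρ W) :=
  (((continuous_quadForm_right W).measurable.const_mul ρ).const_add 1).const_div ρ

theorem rateWeight_nonneg {ρ : ℝ} (hρ : 0 ≤ ρ) {W : Matrix (Fin n) (Fin n) ℂ} (hW : W.PosSemidef)
    (w : Fin n → ℂ) : 0 ≤ rateWeight ρ W w :=
  div_nonneg hρ (by have := mul_nonneg hρ (quadForm_nonneg hW w); linarith)

theorem rateWeight_le {ρ : ℝ} (hρ : 0 ≤ ρ) {W : Matrix (Fin n) (Fin n) ℂ} (hW : W.PosSemidef)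
    (w : Fin n → ℂ) : rateWeight ρ W w ≤ ρ :=
  div_le_self hρ (by have := mul_nonneg hρ (quadForm_nonneg hW w); linarith)

theorem integrable_mul_star_apply (i j : Fin n) :
    Integrable (fun w : Fin n → ℂ => w i * star (w j)) (stdComplexGaussianVec n) := by
  refine integrable_sum_norm_sq.mono' (Continuous.aestronglyMeasurable (by fun_prop))
    (.of_forall fun w => ?_)
  rw [norm_mul, norm_star]
  exact norm_mul_norm_le_sum_sq w i j

theorem dotProduct_mul_dotProduct_star (x y w : Fin n → ℂ) :
    (x ⬝ᵥ w) * (star w ⬝ᵥ y) = ∑ i, ∑ j, x i * y j * (w i * star (w j)) := by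
  simp only [dotProduct, Finset.sum_mul_sum, Pi.star_apply]
  exact Finset.sum_congr rfl fun i _ => Finset.sum_congr rfl fun j _ => by ring

theorem integrable_dotProduct_mul_dotProduct_star (x y : Fin n → ℂ) :
    Integrable (fun w : Fin n → ℂ => (x ⬝ᵥ w) * (star w ⬝ᵥ y)) (stdComplexGaussianVec n) := by
  simp_rw [dotProduct_mul_dotProduct_star]
  exact integrable_finsetSum _ fun i _ => integrable_finsetSum _ fun j _ =>
    (integrable_mul_star_apply i j).const_mul _

theorem integrable_mul_rateWeight {ρ : ℝ} (hρ : 0 ≤ ρ) {W : Matrix (Fin n) (Fin n) ℂ}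
    (hW : W.PosSemidef) {f : (Fin n → ℂ) → ℂ} (hf : Integrable f (stdComplexGaussianVec n)) :
    Integrable (fun w => f w * (rateWeight ρ W w : ℂ)) (stdComplexGaussianVec n) :=
  hf.mul_bdd (c := ρ)
    (Complex.measurable_ofReal.comp (measurable_rateWeight ρ W)).aestronglyMeasurable
    (.of_forall fun w => by
      rw [Complex.norm_real, Real.norm_of_nonneg (rateWeight_nonneg hρ hW w)]
      exact rateWeight_le hρ hW w)

theorem integral_dotProduct_mul_rateWeight {ρ : ℝ} (hρ : 0 ≤ ρ) {W : Matrix (Fin n) (Fin n) ℂ}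
    (hW : W.PosSemidef) (x y : Fin n → ℂ) :
    ∫ w, (x ⬝ᵥ w) * (star w ⬝ᵥ y) * (rateWeight ρ W w : ℂ) ∂stdComplexGaussianVec n =
      x ⬝ᵥ rateGradient ρ W *ᵥ y := by
  have hint : ∀ i j, Integrable (fun w : Fin n → ℂ =>
      x i * y j * (w i * star (w j) * (rateWeight ρ W w : ℂ))) (stdComplexGaussianVec n) :=
    fun i j => (integrable_mul_rateWeight hρ hW (integrable_mul_star_apply i j)).const_mul _
  simp_rw [dotProduct_mul_dotProduct_star, Finset.sum_mul, mul_assoc (_ * _) _ (Complex.ofReal _)]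
  rw [integral_finsetSum _ fun i _ => integrable_finsetSum _ fun j _ => hint i j]
  simp only [dotProduct, mulVec, Finset.mul_sum]
  refine Finset.sum_congr rfl fun i _ => ?_
  rw [integral_finsetSum _ fun j _ => hint i j]
  refine Finset.sum_congr rfl fun j _ => ?_
  rw [integral_const_mul, rateGradient, of_apply]
  ring

theorem rateGradient_isHermitian (ρ : ℝ) (W : Matrix (Fin n) (Fin n) ℂ) :
    (rateGradient ρ W).IsHermitian := by
  ext i j
  rw [conjTranspose_apply, rateGradient, of_apply, of_apply, RCLike.star_def, ← integral_conj]
  congr with w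
  simp [mul_comm]

/-- The gradient is equivariant under unitary conjugation. -/
theorem rateGradient_unitary {ρ : ℝ} (hρ : 0 ≤ ρ) {W U : Matrix (Fin n) (Fin n) ℂ}
    (hW : W.PosSemidef) (hU : U ∈ unitaryGroup (Fin n) ℂ) :
    rateGradient ρ (U * W * Uᴴ) = U * rateGradient ρ W * Uᴴ := by
  have hU' : Uᴴ * U = 1 := mem_unitaryGroup_iff'.1 hU
  ext k l
  have h1 : (U * rateGradient ρ W * Uᴴ) k l = U k ⬝ᵥ rateGradient ρ W *ᵥ fun j => star (U l j) := by
    rw [Matrix.mul_assoc, mul_apply]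
    simp only [dotProduct, mulVec, mul_apply, conjTranspose_apply]
  rw [h1, ← integral_dotProduct_mul_rateWeight hρ hW, rateGradient, of_apply]
  -- Substitute Uw for w: the weight of UWU† at Uw is the weight of W at w.
  conv_lhs => rw [← (measurePreserving_unitary hU).map_eq]
  rw [integral_map (measurable_mulVec U).aemeasurable]
  · congr with w
    have h2 : Uᴴ * (U * W * Uᴴ) * U = W := by
      calc Uᴴ * (U * W * Uᴴ) * U = (Uᴴ * U) * W * (Uᴴ * U) := by simp only [Matrix.mul_assoc]
        _ = W := by rw [hU', Matrix.one_mul, Matrix.mul_one]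
    rw [rateWeight, rateWeight, quadForm_mulVec, h2]
    congr 2
    simp only [mulVec, dotProduct, star_sum, star_mul, Pi.star_apply]

  · exact ((Continuous.measurable (by fun_prop)).mul
      (Complex.measurable_ofReal.comp (measurable_rateWeight ρ _))).aestronglyMeasurable

/-- Flipping the sign of coordinate `k` is a unitary that fixes the diagonal matrix and negates the
`(k, l)` entry of its gradient. -/
theorem rateGradient_diagonal_apply_ne {ρ : ℝ} (hρ : 0 ≤ ρ) {c : Fin n → ℝ} (hc : ∀ i, 0 ≤ c i)
    {k l : Fin n} (hkl : k ≠ l) :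
    rateGradient ρ (diagonal fun i => (c i : ℂ)) k l = 0 := by
  set d : Fin n → ℂ := fun i => if i = k then -1 else 1 with hd
  have hstar : star d = d := by ext i; by_cases h : i = k <;> simp [hd, h]
  have hdd : ∀ i, d i * d i = 1 := by intro i; by_cases h : i = k <;> simp [hd, h]
  have hU : diagonal d ∈ unitaryGroup (Fin n) ℂ := by
    rw [mem_unitaryGroup_iff, star_eq_conjTranspose, diagonal_conjTranspose, hstar,
      diagonal_mul_diagonal]
    simp [hdd]
  have h := rateGradient_unitary hρ (posSemidef_diagonal_ofReal hc) hU
  have h2 : diagonal d * (diagonal fun i => (c i : ℂ)) * (diagonal d)ᴴ =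
      diagonal fun i => (c i : ℂ) := by
    rw [diagonal_conjTranspose, hstar, diagonal_mul_diagonal, diagonal_mul_diagonal]
    congr with i
    rw [mul_right_comm, hdd, one_mul]
  rw [h2, diagonal_conjTranspose, hstar] at h
  have h3 := congrFun (congrFun h k) l
  rw [mul_diagonal, diagonal_mul] at h3
  have h4 : d k = -1 := by simp [hd]
  have h5 : d l = 1 := by simp [hd, hkl.symm]
  rw [h4, h5] at h3
  linear_combination h3 / 2

theorem rateGradient_apply_self (ρ : ℝ) (W : Matrix (Fin n) (Fin n) ℂ) (i : Fin n) :
    rateGradient ρ W i i =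
      ((∫ w, ‖w i‖ ^ 2 * rateWeight ρ W w ∂stdComplexGaussianVec n : ℝ) : ℂ) := by
  rw [rateGradient, of_apply, ← integral_complex_ofReal]
  congr with w
  rw [RCLike.star_def, Complex.mul_conj']
  push_cast
  rfl

/-- Over the common denominator the numerator is r(a − b)(x + y) + 2(a − b)(a + b)xy. The two
fractions are exchanged samples in `mul_rateGradient_diagonal_lt`; a single one may be negative. -/
theorem swap_weight_pos {a b r x y : ℝ} (hr : 0 < r) (hb : 0 ≤ b) (hab : b < a)
    (hx : 0 < x) (hy : 0 < y) :
    0 < (a * x - b * y) / (r + (a * x + b * y)) + (a * y - b * x) / (r + (a * y + b * x)) := by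
  have ha : 0 < a := hb.trans_lt hab
  have h1 : 0 < r + (a * x + b * y) := by positivity
  have h2 : 0 < r + (a * y + b * x) := by positivity
  rw [div_add_div _ _ h1.ne' h2.ne']
  refine div_pos ?_ (mul_pos h1 h2)
  have h3 : 0 < r * (a - b) * (x + y) := by have := sub_pos.2 hab; positivity
  have h4 : 0 < (a - b) * (a + b) * (x * y) := by have := sub_pos.2 hab; positivity
  nlinarith

/-- The map `λᵢ ↦ λᵢ eᵢ`, with `eᵢ` the diagonal entries of the gradient at `diag(λ)`, is
strictly increasing. -/
theorem mul_rateGradient_diagonal_lt {ρ : ℝ} (hρ : 0 < ρ) {c : Fin n → ℝ} (hc : ∀ i, 0 ≤ c i)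
    {i j : Fin n} (hij : c j < c i) :
    c j * ∫ w, ‖w j‖ ^ 2 * rateWeight ρ (diagonal fun i => (c i : ℂ)) w ∂stdComplexGaussianVec n <
    c i * ∫ w, ‖w i‖ ^ 2 * rateWeight ρ (diagonal fun i => (c i : ℂ)) w ∂stdComplexGaussianVec n := by
  have hW := posSemidef_diagonal_ofReal hc
  set W : Matrix (Fin n) (Fin n) ℂ := diagonal fun i => (c i : ℂ) with hWdef
  have hne : i ≠ j := by rintro rfl; exact lt_irrefl _ hij
  have hint : ∀ k, Integrable (fun w : Fin n → ℂ => ‖w k‖ ^ 2 * rateWeight ρ W w)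
      (stdComplexGaussianVec n) := fun k =>
    (integrable_norm_sq_apply k).mul_bdd (c := ρ) (measurable_rateWeight ρ W).aestronglyMeasurable
      (.of_forall fun w => by
        rw [Real.norm_of_nonneg (rateWeight_nonneg hρ.le hW w)]
        exact rateWeight_le hρ.le hW w)
  set f : (Fin n → ℂ) → ℝ := fun w => (c i * ‖w i‖ ^ 2 - c j * ‖w j‖ ^ 2) * rateWeight ρ W w
    with hf
  have hfeq : f = fun w => c i * (‖w i‖ ^ 2 * rateWeight ρ W w) -
      c j * (‖w j‖ ^ 2 * rateWeight ρ W w) := by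
    funext w; simp only [hf]; ring
  have hfint : Integrable f (stdComplexGaussianVec n) := by
    rw [hfeq]; exact ((hint i).const_mul _).sub ((hint j).const_mul _)
  have hsub : ∫ w, f w ∂stdComplexGaussianVec n =
      c i * ∫ w, ‖w i‖ ^ 2 * rateWeight ρ W w ∂stdComplexGaussianVec n -
      c j * ∫ w, ‖w j‖ ^ 2 * rateWeight ρ W w ∂stdComplexGaussianVec n := by
    rw [hfeq, integral_sub ((hint i).const_mul _) ((hint j).const_mul _), integral_const_mul,
      integral_const_mul]
  -- Exchanging coordinates `i` and `j` preserves the law, so 2∫f = ∫(f + f ∘ s), and this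
  -- symmetrized integrand is positive almost everywhere although `f` need not be.
  have hσ := measurePreserving_comp_equiv (Equiv.swap i j)
  set s : (Fin n → ℂ) → Fin n → ℂ := fun w k => w (Equiv.swap i j k) with hs
  have hgint : Integrable (fun w => f (s w)) (stdComplexGaussianVec n) :=
    hσ.integrable_comp_of_integrable hfint
  have hgeq : ∫ w, f (s w) ∂stdComplexGaussianVec n = ∫ w, f w ∂stdComplexGaussianVec n := by
    conv_rhs => rw [← hσ.map_eq]
    rw [integral_map hσ.measurable.aemeasurable]
    rw [hσ.map_eq]
    exact hfint.aestronglyMeasurable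
  have hpos : ∀ w : Fin n → ℂ, w i ≠ 0 → w j ≠ 0 → 0 < f w + f (s w) := by
    intro w hi hj
    -- The first bracket does not involve coordinates `i`, `j`, so it is unchanged by the swap and
    -- plays the role of `r` in `swap_weight_pos`.
    have hsplit : ∀ v : Fin n → ℂ, 1 + ρ * quadForm W v =
        (1 + ρ * ∑ k ∈ {i, j}ᶜ, c k * ‖v k‖ ^ 2) +
          (ρ * c i * ‖v i‖ ^ 2 + ρ * c j * ‖v j‖ ^ 2) := by
      intro v
      rw [hWdef, quadForm_diagonal, ← Finset.sum_add_sum_compl {i, j}, Finset.sum_pair hne]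
      ring
    have hsi : s w i = w j := by simp [hs]
    have hsj : s w j = w i := by simp [hs]
    have hsk : ∑ k ∈ {i, j}ᶜ, c k * ‖s w k‖ ^ 2 = ∑ k ∈ {i, j}ᶜ, c k * ‖w k‖ ^ 2 := by
      refine Finset.sum_congr rfl fun k hk => ?_
      simp only [Finset.mem_compl, Finset.mem_insert, Finset.mem_singleton, not_or] at hk
      simp only [hs, Equiv.swap_apply_of_ne_of_ne hk.1 hk.2]
    have hr : 0 < 1 + ρ * ∑ k ∈ {i, j}ᶜ, c k * ‖w k‖ ^ 2 := by
      have : 0 ≤ ∑ k ∈ {i, j}ᶜ, c k * ‖w k‖ ^ 2 :=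
        Finset.sum_nonneg fun k _ => mul_nonneg (hc k) (sq_nonneg _)
      positivity
    have key := swap_weight_pos (a := ρ * c i) (b := ρ * c j) (x := ‖w i‖ ^ 2) (y := ‖w j‖ ^ 2) hr
      (mul_nonneg hρ.le (hc j)) (mul_lt_mul_of_pos_left hij hρ)
      (pow_pos (norm_pos_iff.2 hi) 2) (pow_pos (norm_pos_iff.2 hj) 2)
    refine key.trans_eq ?_
    simp only [hf, rateWeight]
    rw [hsplit w, hsplit (s w), hsk, hsi, hsj]
    ring
  have hsum : 0 < ∫ w, f w + f (s w) ∂stdComplexGaussianVec n := by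
    have hae : ∀ᵐ w ∂stdComplexGaussianVec n, 0 < f w + f (s w) := by
      filter_upwards [ae_apply_ne_zero i, ae_apply_ne_zero j] with w hi hj using hpos w hi hj
    rw [integral_pos_iff_support_of_nonneg_ae (hae.mono fun w hw => hw.le) (hfint.add hgint)]
    have : Function.support (fun w => f w + f (s w)) =ᵐ[stdComplexGaussianVec n] Set.univ := by
      filter_upwards [hae] with w hw
      exact propext (iff_true_intro hw.ne')
    rw [measure_congr this]
    simp
  rw [integral_add hfint hgint, hgeq, hsub] at hsum
  linarith

end Gradient

/-! ### First-order condition on the unitary orbit. -/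

section Stationarity

/-- The unitary `1 + (e^{iθ} - 1) v v†`, for a unit vector `v`. -/
noncomputable def phaseUnitary (v : Fin n → ℂ) (θ : ℝ) : Matrix (Fin n) (Fin n) ℂ :=
  1 + (Complex.exp (θ * Complex.I) - 1) • vecMulVec v (star v)

theorem conjTranspose_phaseUnitary (v : Fin n → ℂ) (θ : ℝ) :
    (phaseUnitary v θ)ᴴ = phaseUnitary v (-θ) := by
  rw [phaseUnitary, phaseUnitary, conjTranspose_add, conjTranspose_one, conjTranspose_smul,
    conjTranspose_vecMulVec, star_star, star_sub, star_one, RCLike.star_def, ← Complex.exp_conj]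
  simp

theorem phaseUnitary_mul {v : Fin n → ℂ} (hv : star v ⬝ᵥ v = 1) (θ φ : ℝ) :
    phaseUnitary v θ * phaseUnitary v φ = phaseUnitary v (θ + φ) := by
  have hP : vecMulVec v (star v) * vecMulVec v (star v) = vecMulVec v (star v) := by
    rw [vecMulVec_mul_vecMulVec, hv, one_smul]
  simp only [phaseUnitary]
  rw [add_mul, mul_add, mul_add, smul_mul_smul_comm, hP, one_mul, mul_one, one_mul]
  push_cast
  rw [add_mul (θ : ℂ), Complex.exp_add]
  module

theorem phaseUnitary_zero (v : Fin n → ℂ) : phaseUnitary v 0 = 1 := by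
  simp [phaseUnitary]

theorem phaseUnitary_mem {v : Fin n → ℂ} (hv : star v ⬝ᵥ v = 1) (θ : ℝ) :
    phaseUnitary v θ ∈ unitaryGroup (Fin n) ℂ := by
  rw [mem_unitaryGroup_iff, star_eq_conjTranspose, conjTranspose_phaseUnitary, phaseUnitary_mul hv,
    add_neg_cancel, phaseUnitary_zero]

/-- With s = v†h, the adjoint phase unitary sends h to h + (e^{-iθ} − 1)s v; expand, using |e^{-iθ}
− 1|² = 2 − 2cos θ. At θ = 0 the derivative is 2 Im(s · h†Av). -/
theorem quadForm_phaseUnitary {A : Matrix (Fin n) (Fin n) ℂ} (hA : A.IsHermitian)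
    (v h : Fin n → ℂ) (θ : ℝ) :
    quadForm A ((phaseUnitary v θ)ᴴ *ᵥ h) =
      quadForm A h + 2 * ((Real.cos θ - 1) * ((star v ⬝ᵥ h) * (star h ⬝ᵥ A *ᵥ v)).re +
        Real.sin θ * ((star v ⬝ᵥ h) * (star h ⬝ᵥ A *ᵥ v)).im) +
        (2 - 2 * Real.cos θ) * (‖star v ⬝ᵥ h‖ ^ 2 * quadForm A v) := by
  set s := star v ⬝ᵥ h with hs
  set b := star h ⬝ᵥ A *ᵥ v with hb
  have hb' : star v ⬝ᵥ A *ᵥ h = star b := by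
    rw [hb, dotProduct_mulVec, ← hA.eq, ← star_mulVec, hA.eq, star_dotProduct]
  set c : ℂ := Complex.exp ((-θ : ℝ) * Complex.I) - 1 with hc
  have hcre : c.re = Real.cos θ - 1 := by
    rw [hc, Complex.sub_re, Complex.exp_ofReal_mul_I_re, Complex.one_re, Real.cos_neg]
  have hcim : c.im = -Real.sin θ := by
    rw [hc, Complex.sub_im, Complex.exp_ofReal_mul_I_im, Complex.one_im, Real.sin_neg, sub_zero]
  have hexp : (phaseUnitary v θ)ᴴ *ᵥ h = h + (c * s) • v := by
    rw [conjTranspose_phaseUnitary, phaseUnitary, add_mulVec, one_mulVec, smul_mulVec,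
      vecMulVec_mulVec, ← hs, ← hc]
    simp [smul_smul]
  rw [hexp, quadForm, star_add, mulVec_add, add_dotProduct, dotProduct_add, dotProduct_add,
    mulVec_smul, star_smul, smul_dotProduct, smul_dotProduct, dotProduct_smul, dotProduct_smul,
    hb', ← hb]
  simp only [smul_eq_mul, quadForm]
  have him : (star v ⬝ᵥ A *ᵥ v).im = 0 := by
    have : star v ⬝ᵥ A *ᵥ v = star (star v ⬝ᵥ A *ᵥ v) := by
      conv_rhs => rw [star_dotProduct, star_mulVec, hA.eq, star_star, ← dotProduct_mulVec]
    exact Complex.conj_eq_iff_im.1 this.symm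
  rw [Complex.sq_norm, Complex.normSq_apply]
  simp only [Complex.add_re, Complex.mul_re, Complex.mul_im, RCLike.star_def, Complex.conj_re,
    Complex.conj_im, hcre, hcim, him]
  have := Real.sin_sq_add_cos_sq θ
  linear_combination ((s.re ^ 2 + s.im ^ 2) * (star v ⬝ᵥ A *ᵥ v).re) * this

/-- First order condition along the curve `phaseUnitary v`. -/
theorem im_eq_zero_of_forall_unitary_le {ρ : ℝ} (hρ : 0 ≤ ρ) {A S : Matrix (Fin n) (Fin n) ℂ}
    (hA : A.PosSemidef) (hS : S.IsHermitian)
    (hmax : ∀ U ∈ unitaryGroup (Fin n) ℂ, stdRate ρ (S * (U * A * Uᴴ) * S) ≤ stdRate ρ (S * A * S))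
    {v : Fin n → ℂ} (hv : star v ⬝ᵥ v = 1) :
    (star v ⬝ᵥ (S * rateGradient ρ (S * A * S) * S * A) *ᵥ v).im = 0 := by
  have hW : (S * A * S).PosSemidef := by
    have := hA.conjTranspose_mul_mul_same S
    rwa [hS.eq] at this
  -- Chosen so that v†(SMSA)v = x · My, with M the gradient at SAS.
  set x : Fin n → ℂ := star v ᵥ* S with hx
  set y : Fin n → ℂ := S *ᵥ A *ᵥ v with hy
  set β : (Fin n → ℂ) → ℂ := fun w => (x ⬝ᵥ w) * (star w ⬝ᵥ y) with hβ
  set κ : (Fin n → ℂ) → ℝ := fun w => ‖x ⬝ᵥ w‖ ^ 2 * quadForm A v with hκ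
  have hβint : Integrable β (stdComplexGaussianVec n) :=
    integrable_dotProduct_mul_dotProduct_star x y
  have hκint : Integrable κ (stdComplexGaussianVec n) := by
    refine Integrable.mul_const ?_ _
    refine (integrable_dotProduct_mul_dotProduct_star x (star x)).norm.congr (.of_forall fun w => ?_)
    simp only [norm_mul]
    rw [star_dotProduct_star, norm_star, sq]
  have hκ0 : ∀ w, 0 ≤ κ w := fun w => mul_nonneg (sq_nonneg _) (quadForm_nonneg hA v)
  set g : ℝ → (Fin n → ℂ) → ℝ := fun θ w => quadForm (S * A * S) w +
    2 * ((Real.cos θ - 1) * (β w).re + Real.sin θ * (β w).im) + (2 - 2 * Real.cos θ) * κ w with hg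
  have hconj : ∀ θ, (S * (phaseUnitary v θ * A * (phaseUnitary v θ)ᴴ) * S).PosSemidef := by
    intro θ
    have := (hA.mul_mul_conjTranspose_same (phaseUnitary v θ)).conjTranspose_mul_mul_same S
    rwa [hS.eq] at this
  have hquad : ∀ θ w,
      quadForm (S * (phaseUnitary v θ * A * (phaseUnitary v θ)ᴴ) * S) w = g θ w := by
    intro θ w
    have h1 : quadForm (S * (phaseUnitary v θ * A * (phaseUnitary v θ)ᴴ) * S) w =
        quadForm A ((phaseUnitary v θ)ᴴ *ᵥ (S *ᵥ w)) := by
      rw [quadForm_mulVec, quadForm_mulVec, conjTranspose_conjTranspose, hS.eq]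
    have h2 : star v ⬝ᵥ S *ᵥ w = x ⬝ᵥ w := by rw [hx, dotProduct_mulVec]
    have h3 : star (S *ᵥ w) ⬝ᵥ A *ᵥ v = star w ⬝ᵥ y := by
      rw [hy, star_mulVec, hS.eq, ← dotProduct_mulVec]
    have h4 : quadForm A (S *ᵥ w) = quadForm (S * A * S) w := by rw [quadForm_mulVec, hS.eq]
    rw [h1, quadForm_phaseUnitary hA.isHermitian, h2, h3, h4]
  have hg0 : ∀ θ w, 0 ≤ g θ w := fun θ w => by
    rw [← hquad]; exact quadForm_nonneg (hconj θ) w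
  have hpos : ∀ θ w, 0 < 1 + ρ * g θ w := fun θ w => by
    have := mul_nonneg hρ (hg0 θ w); linarith
  set g' : ℝ → (Fin n → ℂ) → ℝ := fun θ w =>
    2 * (-Real.sin θ * (β w).re + Real.cos θ * (β w).im) + 2 * Real.sin θ * κ w with hg'
  have hgderiv : ∀ θ w, HasDerivAt (fun θ => g θ w) (g' θ w) θ := by
    intro θ w
    have hcos := Real.hasDerivAt_cos θ
    have hsin := Real.hasDerivAt_sin θ
    have h := ((((hcos.sub_const 1).mul_const (β w).re).add (hsin.mul_const (β w).im)).const_mul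
      2).const_add (quadForm (S * A * S) w) |>.add (((hcos.const_mul 2).const_sub 2).mul_const (κ w))
    refine h.congr_deriv ?_
    simp only [hg']
    ring
  -- The bound is uniform in θ and integrable in w, which permits differentiation under the integral
  -- on the whole line.
  have hbound : ∀ θ w, |g' θ w| ≤ 2 * (2 * ‖β w‖ + κ w) := by
    intro θ w
    have h1 := Complex.abs_re_le_norm (β w)
    have h2 := Complex.abs_im_le_norm (β w)
    have h3 := Real.abs_sin_le_one θ
    have h4 := Real.abs_cos_le_one θ
    have h5 : |Real.sin θ * (β w).re| ≤ ‖β w‖ := by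
      rw [abs_mul]; nlinarith [abs_nonneg (Real.sin θ), abs_nonneg (β w).re]
    have h6 : |Real.cos θ * (β w).im| ≤ ‖β w‖ := by
      rw [abs_mul]; nlinarith [abs_nonneg (Real.cos θ), abs_nonneg (β w).im]
    have h7 : |Real.sin θ * κ w| ≤ κ w := by
      rw [abs_mul, abs_of_nonneg (hκ0 w)]; nlinarith [abs_nonneg (Real.sin θ), hκ0 w]
    simp only [hg']
    rw [abs_le] at *
    constructor <;> linarith [h5.1, h5.2, h6.1, h6.2, h7.1, h7.2]
  have hderiv := hasDerivAt_integral_of_dominated_loc_of_deriv_le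
    (μ := stdComplexGaussianVec n) (x₀ := (0 : ℝ)) (s := Set.univ)
    (F := fun θ => logRate ρ (S * (phaseUnitary v θ * A * (phaseUnitary v θ)ᴴ) * S))
    (F' := fun θ w => ρ * g' θ w / (1 + ρ * g θ w))
    (bound := fun w => ρ * (2 * (2 * ‖β w‖ + κ w))) Filter.univ_mem
    (.of_forall fun θ => (measurable_logRate ρ _).aestronglyMeasurable)
    (integrable_logRate hρ (hconj 0))
    (by
      have hβm : Measurable β := Continuous.measurable (by fun_prop)
      have hκm : Measurable κ := Continuous.measurable (by fun_prop)
      have hqm := (continuous_quadForm_right (S * A * S)).measurable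
      simp only [hg', hg]
      exact Measurable.aestronglyMeasurable (by fun_prop))
    (.of_forall fun w θ _ => by
      have h1 : |ρ * g' θ w| ≤ ρ * (2 * (2 * ‖β w‖ + κ w)) := by
        rw [abs_mul, abs_of_nonneg hρ]
        exact mul_le_mul_of_nonneg_left (hbound θ w) hρ
      rw [Real.norm_eq_abs, abs_div, abs_of_pos (hpos θ w)]
      refine (div_le_self (abs_nonneg _) ?_).trans h1
      have := mul_nonneg hρ (hg0 θ w)
      linarith)
    ((((hβint.norm.const_mul 2).add hκint).const_mul 2).const_mul ρ)
    (.of_forall fun w θ _ => by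
      simp_rw [logRate_eq, hquad]
      exact ((((hgderiv θ w).const_mul ρ).const_add 1).log (hpos θ w).ne'))
  have hloc : IsLocalMax (fun θ => ∫ w, logRate ρ
      (S * (phaseUnitary v θ * A * (phaseUnitary v θ)ᴴ) * S) w ∂stdComplexGaussianVec n) 0 := by
    refine .of_forall fun θ => ?_
    have h := hmax _ (phaseUnitary_mem hv θ)
    simpa only [phaseUnitary_zero, conjTranspose_one, Matrix.one_mul, Matrix.mul_one,
      stdRate] using h
  have hzero := hloc.hasDerivAt_eq_zero hderiv.2
  have hF0 : ∀ w, ρ * g' 0 w / (1 + ρ * g 0 w) =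
      2 * (β w * (rateWeight ρ (S * A * S) w : ℂ)).im := by
    intro w
    simp only [hg', hg, Complex.im_mul_ofReal, rateWeight, Real.sin_zero, Real.cos_zero]
    ring_nf
  simp_rw [hF0] at hzero
  have him : ∫ w, (β w * (rateWeight ρ (S * A * S) w : ℂ)).im ∂stdComplexGaussianVec n =
      (∫ w, β w * (rateWeight ρ (S * A * S) w : ℂ) ∂stdComplexGaussianVec n).im :=
    integral_im (integrable_mul_rateWeight hρ hW hβint)
  rw [integral_const_mul, him, integral_dotProduct_mul_rateWeight hρ hW] at hzero
  have hfin : star v ⬝ᵥ (S * rateGradient ρ (S * A * S) * S * A) *ᵥ v =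
      x ⬝ᵥ rateGradient ρ (S * A * S) *ᵥ y := by
    rw [hx, hy, ← dotProduct_mulVec]
    simp only [mulVec_mulVec, Matrix.mul_assoc]
  rw [hfin]
  linarith

/-- Rescaling passes from unit vectors to all vectors; over ℂ an operator with real quadratic form
is symmetric. -/
theorem isHermitian_of_forall_unit_im_eq_zero {X : Matrix (Fin n) (Fin n) ℂ}
    (hX : ∀ v : Fin n → ℂ, star v ⬝ᵥ v = 1 → (star v ⬝ᵥ X *ᵥ v).im = 0) : X.IsHermitian := by
  have hall : ∀ v : Fin n → ℂ, (star v ⬝ᵥ X *ᵥ v).im = 0 := by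
    intro v
    by_cases hv : v = 0
    · simp [hv]
    set r : ℝ := ∑ i, ‖v i‖ ^ 2 with hr
    have hrv : star v ⬝ᵥ v = (r : ℂ) := by simp [hr, dotProduct, Complex.conj_mul']
    have hr0 : 0 < r := by
      refine lt_of_le_of_ne (Finset.sum_nonneg fun i _ => sq_nonneg _) fun h => hv ?_
      rw [← h, Complex.ofReal_zero] at hrv
      exact dotProduct_star_self_eq_zero.1 hrv
    have h := hX (((√r)⁻¹ : ℝ) • v) (by
      rw [star_smul, smul_dotProduct, dotProduct_smul, hrv, star_trivial, smul_smul, ← mul_inv,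
        Real.mul_self_sqrt hr0.le, Complex.real_smul, ← Complex.ofReal_mul, inv_mul_cancel₀ hr0.ne',
        Complex.ofReal_one])
    rw [star_smul, mulVec_smul, smul_dotProduct, dotProduct_smul, star_trivial, smul_smul,
      ← mul_inv, Real.mul_self_sqrt hr0.le, Complex.smul_im, smul_eq_mul] at h
    exact (mul_eq_zero.1 h).resolve_left (inv_ne_zero hr0.ne')
  rw [← isSymmetric_toEuclideanLin_iff, LinearMap.isSymmetric_iff_inner_map_self_real]
  intro v
  rw [Complex.conj_eq_iff_im, EuclideanSpace.inner_eq_star_dotProduct]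
  have h := hall v.ofLp
  have h2 : star (star v.ofLp ⬝ᵥ X *ᵥ v.ofLp) = v.ofLp ⬝ᵥ star ((toEuclideanLin X v).ofLp) := by
    rw [star_dotProduct, star_star, dotProduct_comm]
    rfl
  rw [← h2]
  simpa using h

end Stationarity

/-! ### From stationarity to diagonality. -/

section Diagonalization

theorem exists_unitary_diagonal {W : Matrix (Fin n) (Fin n) ℂ} (hW : W.PosSemidef) :
    ∃ U ∈ unitaryGroup (Fin n) ℂ, ∃ c : Fin n → ℝ, (∀ i, 0 ≤ c i) ∧ W = conjDiag U c := by
  refine ⟨hW.isHermitian.eigenvectorUnitary, SetLike.coe_mem _, hW.isHermitian.eigenvalues,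
    hW.eigenvalues_nonneg, ?_⟩
  conv_lhs => rw [hW.isHermitian.spectral_theorem, Unitary.conjStarAlgAut_apply]
  rfl

theorem conjDiag_apply (U : Matrix (Fin n) (Fin n) ℂ) (c : Fin n → ℝ) (k l : Fin n) :
    conjDiag U c k l = ∑ i, U k i * c i * star (U l i) := by
  simp [conjDiag, mul_apply, diagonal_apply]

/-- Equivariance reduces to a diagonal argument, where sign flips kill the off-diagonal entries. So
a matrix and its gradient share an eigenbasis and commute. -/
theorem rateGradient_conjDiag {ρ : ℝ} (hρ : 0 ≤ ρ) {U : Matrix (Fin n) (Fin n) ℂ}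
    (hU : U ∈ unitaryGroup (Fin n) ℂ) {c : Fin n → ℝ} (hc : ∀ i, 0 ≤ c i) :
    rateGradient ρ (conjDiag U c) = conjDiag U fun i =>
      ∫ w, ‖w i‖ ^ 2 * rateWeight ρ (diagonal fun i => (c i : ℂ)) w ∂stdComplexGaussianVec n := by
  rw [conjDiag, rateGradient_unitary hρ (posSemidef_diagonal_ofReal hc) hU, conjDiag]
  congr 2
  ext i j
  by_cases hij : i = j
  · subst hij
    rw [rateGradient_apply_self, diagonal_apply_eq]
  · rw [rateGradient_diagonal_apply_ne hρ hc hij, diagonal_apply_ne _ hij]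

/-- A matrix commuting with a diagonal matrix with distinct entries is diagonal. -/
theorem isDiag_of_commute_diagonal {d : Fin n → ℂ} (hd : Function.Injective d)
    {G : Matrix (Fin n) (Fin n) ℂ} (h : diagonal d * G = G * diagonal d) : G.IsDiag := by
  intro i j hij
  have h1 := congrFun (congrFun h i) j
  rw [diagonal_mul, mul_diagonal] at h1
  have h2 : (d i - d j) * G i j = 0 := by linear_combination h1
  exact (mul_eq_zero.1 h2).resolve_left (sub_ne_zero.2 fun h => hij (hd h))

/-- If `U diag(s) U†` is diagonal and `c` is a function of `s`, then `U diag(c) U†` is diagonal. -/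
theorem isDiag_conjDiag_of_eq_imp {U : Matrix (Fin n) (Fin n) ℂ} (hU : U ∈ unitaryGroup (Fin n) ℂ)
    {s c : Fin n → ℝ} (hsc : ∀ i j, s i = s j → c i = c j) (h : (conjDiag U s).IsDiag) :
    (conjDiag U c).IsDiag := by
  have hU' : Uᴴ * U = 1 := mem_unitaryGroup_iff'.1 hU
  -- All columns that meet row `k` belong to one value of `s`, hence to one value `m` of `c`;
  -- orthogonality of the rows of `U` then finishes.
  have hcol : ∀ k i, U k i ≠ 0 → (s i : ℂ) = conjDiag U s k k := by
    intro k i hki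
    have h1 : diagonal (conjDiag U s).diag * U = U * diagonal fun i => (s i : ℂ) := by
      rw [(isDiag_iff_diagonal_diag _).1 h, conjDiag, Matrix.mul_assoc, hU', Matrix.mul_one]
    have h2 := congrFun (congrFun h1 k) i
    rw [diagonal_mul, mul_diagonal, mul_comm] at h2
    exact (mul_left_cancel₀ hki h2).symm
  intro k l hkl
  obtain ⟨m, hm⟩ : ∃ m : ℝ, ∀ i, U k i ≠ 0 → c i = m := by
    by_cases hex : ∃ i, U k i ≠ 0
    · obtain ⟨i₀, h0⟩ := hex
      refine ⟨c i₀, fun i hi => hsc i i₀ ?_⟩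
      exact_mod_cast (hcol k i hi).trans (hcol k i₀ h0).symm
    · push Not at hex
      exact ⟨0, fun i hi => absurd (hex i) hi⟩
  have horth : ∑ i, U k i * star (U l i) = 0 := by
    have h1 := congrFun (congrFun (mem_unitaryGroup_iff.1 hU) k) l
    rw [one_apply_ne hkl] at h1
    simpa [mul_apply] using h1
  rw [conjDiag_apply]
  calc ∑ i, U k i * c i * star (U l i) = ∑ i, m * (U k i * star (U l i)) := by
        refine Finset.sum_congr rfl fun i _ => ?_
        by_cases hki : U k i = 0
        · simp [hki]
        · rw [hm i hki]; ring
    _ = 0 := by rw [← Finset.mul_sum, horth, mul_zero]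

/-- A maximizer of the ergodic rate over a unitary orbit is diagonal in the eigenbasis of the
channel covariance. -/
theorem isDiag_of_forall_unitary_le {ρ : ℝ} (hρ : 0 < ρ) {η : Fin n → ℝ} (hη : ∀ i, 0 < η i)
    (hdist : Function.Injective η) {A S : Matrix (Fin n) (Fin n) ℂ} (hA : A.PosSemidef)
    (hSdef : S = diagonal fun i => ((√(η i) : ℝ) : ℂ))
    (hmax : ∀ U ∈ unitaryGroup (Fin n) ℂ,
      stdRate ρ (S * (U * A * Uᴴ) * S) ≤ stdRate ρ (S * A * S)) : A.IsDiag := by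
  have hS : S.IsHermitian := by
    rw [hSdef]; exact (posSemidef_diagonal_ofReal fun i => Real.sqrt_nonneg _).isHermitian
  have hSS : S * S = diagonal fun i => (η i : ℂ) := by
    rw [hSdef, diagonal_mul_diagonal]
    congr with i
    rw [← Complex.ofReal_mul, Real.mul_self_sqrt (hη i).le]
  have hW : (S * A * S).PosSemidef := by
    have := hA.conjTranspose_mul_mul_same S
    rwa [hS.eq] at this
  set W := S * A * S with hWdef
  set M := rateGradient ρ W with hM
  have hherm : (S * M * S * A).IsHermitian := isHermitian_of_forall_unit_im_eq_zero fun v hv =>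
    im_eq_zero_of_forall_unitary_le hρ.le hA hS hmax hv
  have hcomm : S * M * S * A = A * (S * M * S) := by
    conv_lhs => rw [← hherm.eq]
    simp only [conjTranspose_mul, hS.eq, hA.isHermitian.eq, (rateGradient_isHermitian ρ W).eq, hM,
      Matrix.mul_assoc]
  obtain ⟨U, hU, c, hc, hWU⟩ := exists_unitary_diagonal hW
  set e : Fin n → ℝ := fun i =>
    ∫ w, ‖w i‖ ^ 2 * rateWeight ρ (diagonal fun i => (c i : ℂ)) w ∂stdComplexGaussianVec n with he
  have hMU : M = conjDiag U e := by rw [hM, hWU, rateGradient_conjDiag hρ.le hU hc]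
  have hMW : M * W = conjDiag U fun i => c i * e i := by
    rw [hMU, hWU, conjDiag_mul_conjDiag hU]
    congr with i
    ring
  have hWM : W * M = conjDiag U fun i => c i * e i := by
    rw [hMU, hWU, conjDiag_mul_conjDiag hU]
  -- The commutation of SMS with A, multiplied by S on both sides, involves A only through W = SAS.
  have hη' : (S * S) * (M * W) = (W * M) * (S * S) := by
    calc (S * S) * (M * W) = S * (S * M * S * A) * S := by simp only [hWdef, Matrix.mul_assoc]
      _ = S * (A * (S * M * S)) * S := by rw [hcomm]
      _ = (W * M) * (S * S) := by simp only [hWdef, Matrix.mul_assoc]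
  rw [hSS, hMW, hWM] at hη'
  have hG := isDiag_of_commute_diagonal (Complex.ofReal_injective.comp hdist) hη'
  have hWdiag : W.IsDiag := by
    rw [hWU]
    refine isDiag_conjDiag_of_eq_imp hU (fun i j hij => ?_) hG
    -- Strict monotonicity of cᵢ ↦ cᵢeᵢ rules out equal products with unequal `c`.
    rcases lt_trichotomy (c i) (c j) with h | h | h
    · exact absurd hij (mul_rateGradient_diagonal_lt hρ hc h).ne
    · exact h
    · exact absurd hij (mul_rateGradient_diagonal_lt hρ hc h).ne'
  intro i j hij
  have h := hWdiag hij
  rw [hWdef, hSdef, mul_diagonal, diagonal_mul] at h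
  have hne : ∀ i, ((√(η i) : ℝ) : ℂ) ≠ 0 := fun i =>
    Complex.ofReal_ne_zero.2 (Real.sqrt_pos.2 (hη i)).ne'
  exact (mul_eq_zero.1 ((mul_eq_zero.1 h).resolve_right (hne j))).resolve_left (hne i)

end Diagonalization

/-! ### Optimal inputs and power allocations. -/

section Optimality

variable {ρ α : ℝ} {V : Matrix (Fin n) (Fin n) ℂ} {η : Fin n → ℝ}

theorem conjTranspose_mul_conjDiag_mul (hV : V ∈ unitaryGroup (Fin n) ℂ) (c : Fin n → ℝ) :
    Vᴴ * conjDiag V c * V = diagonal fun i => (c i : ℂ) := by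
  have h : Vᴴ * V = 1 := mem_unitaryGroup_iff'.1 hV
  rw [conjDiag, Matrix.mul_assoc, Matrix.mul_assoc, Matrix.mul_assoc, h, Matrix.mul_one,
    ← Matrix.mul_assoc, h, Matrix.one_mul]

theorem eigenvalue_pos (hV : V ∈ unitaryGroup (Fin n) ℂ) (h : (conjDiag V η).PosDef) (i : Fin n) :
    0 < η i := by
  have hinj : Function.Injective V.mulVec := by
    refine Function.LeftInverse.injective (g := (Vᴴ).mulVec) fun x => ?_
    rw [mulVec_mulVec, show Vᴴ * V = 1 from mem_unitaryGroup_iff'.1 hV, one_mulVec]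
  have h1 := h.conjTranspose_mul_mul_same hinj
  rw [conjTranspose_mul_conjDiag_mul hV, posDef_diagonal_iff] at h1
  exact_mod_cast h1 i

theorem stdRate_unitary_conjTranspose (ρ : ℝ) (Q : Matrix (Fin n) (Fin n) ℂ) {U : Matrix (Fin n) (Fin n) ℂ}
    (hU : U ∈ unitaryGroup (Fin n) ℂ) : stdRate ρ (U * Q * Uᴴ) = stdRate ρ Q := by
  have h := stdRate_unitary ρ Q (Unitary.star_mem hU)
  rwa [star_eq_conjTranspose, conjTranspose_conjTranspose] at h

theorem isDiag_of_isOptimalInput (hρ : 0 < ρ) (hα : 0 < α) (hV : V ∈ unitaryGroup (Fin n) ℂ)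
    (hη : ∀ i, 0 < η i) (hdist : Function.Injective η) {Q : Matrix (Fin n) (Fin n) ℂ}
    (hQ : IsOptimalInput ρ (conjDiag V η) ((α : ℂ) • 1) Q) : (Vᴴ * Q * V).IsDiag := by
  have hVV : Vᴴ * V = 1 := mem_unitaryGroup_iff'.1 hV
  have hV' : Vᴴ ∈ unitaryGroup (Fin n) ℂ := Unitary.star_mem hV
  refine isDiag_of_forall_unitary_le hρ hη hdist (hQ.1.1.conjTranspose_mul_mul_same V) rfl
    fun U hU => ?_
  -- Conjugating Q by VUV† conjugates V†QV by U and leaves the eavesdropper's rate unchanged, so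
  -- optimality compares the first terms alone.
  have hT : V * U * Vᴴ ∈ unitaryGroup (Fin n) ℂ := mul_mem (mul_mem hV hU) hV'
  have h := isMaxOn_iff.1 hQ.2 _ (mem_feasibleSet_unitary hQ.1 hT)
  rw [ergodicSecrecyRate_eq ρ hα.le hV (fun i => (hη i).le),
    ergodicSecrecyRate_eq ρ hα.le hV (fun i => (hη i).le), stdRate_unitary_conjTranspose _ _ hT] at h
  have h1 : Vᴴ * (V * U * Vᴴ * Q * (V * U * Vᴴ)ᴴ) * V = U * (Vᴴ * Q * V) * Uᴴ := by
    calc Vᴴ * (V * U * Vᴴ * Q * (V * U * Vᴴ)ᴴ) * V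
        = (Vᴴ * V) * U * (Vᴴ * Q * V) * Uᴴ * (Vᴴ * V) := by
          simp only [conjTranspose_mul, conjTranspose_conjTranspose, Matrix.mul_assoc]
      _ = _ := by rw [hVV, Matrix.one_mul, Matrix.mul_one]
  rw [h1] at h
  linarith

theorem ergodicSecrecyRate_conjDiag (hα : 0 ≤ α) (hV : V ∈ unitaryGroup (Fin n) ℂ)
    (hη : ∀ i, 0 ≤ η i) (ζ : Fin n → ℝ) :
    ergodicSecrecyRate ρ (conjDiag V η) ((α : ℂ) • 1) (conjDiag V ζ) =
      allocationRate ρ α η ζ := by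
  have h : (diagonal fun i => ((√(η i) : ℝ) : ℂ)) * (diagonal fun i => (ζ i : ℂ)) *
      (diagonal fun i => ((√(η i) : ℝ) : ℂ)) = diagonal fun i => ((η i * ζ i : ℝ) : ℂ) := by
    rw [diagonal_mul_diagonal, diagonal_mul_diagonal]
    congr with i
    rw [mul_right_comm, ← Complex.ofReal_mul, Real.mul_self_sqrt (hη i), Complex.ofReal_mul]
  rw [ergodicSecrecyRate_eq ρ hα hV hη, conjTranspose_mul_conjDiag_mul hV, h,
    conjDiag, stdRate_unitary_conjTranspose _ _ hV, stdRate, stdRate, logRate_diagonal,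
    logRate_diagonal, allocationRate]

theorem exists_isOptimalInput (hn : 0 < n) (hρ : 0 ≤ ρ) (hα : 0 ≤ α)
    (hV : V ∈ unitaryGroup (Fin n) ℂ) (hη : ∀ i, 0 ≤ η i) :
    ∃ Q, IsOptimalInput ρ (conjDiag V η) ((α : ℂ) • 1) Q := by
  have hne : (feasibleSet n).Nonempty :=
    ⟨_, conjDiag_mem_feasibleSet hV (single_mem_stdSimplex ℝ (⟨0, hn⟩ : Fin n))⟩
  refine isCompact_feasibleSet.exists_isMaxOn hne ?_
  refine ContinuousOn.congr (ContinuousOn.sub ?_ ?_) fun Q _ =>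
    ergodicSecrecyRate_eq ρ hα hV hη Q
  · have hS := (posSemidef_diagonal_ofReal fun i => Real.sqrt_nonneg (η i)).isHermitian
    generalize (diagonal fun i => ((√(η i) : ℝ) : ℂ)) = S at hS ⊢
    have hcont : Continuous fun Q : Matrix (Fin n) (Fin n) ℂ => S * (Vᴴ * Q * V) * S :=
      (continuous_const.matrix_mul ((continuous_const.matrix_mul continuous_id).matrix_mul
        continuous_const)).matrix_mul continuous_const
    have hmaps : Set.MapsTo (fun Q : Matrix (Fin n) (Fin n) ℂ => S * (Vᴴ * Q * V) * S)
        (feasibleSet n) {Q | Q.PosSemidef} := by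
      intro Q hQ
      have := (hQ.1.conjTranspose_mul_mul_same V).conjTranspose_mul_mul_same S
      rwa [hS.eq] at this
    exact (continuousOn_stdRate hρ).comp hcont.continuousOn hmaps
  · exact (continuousOn_stdRate (mul_nonneg hα hρ)).mono fun Q hQ => hQ.1

theorem exists_eq_conjDiag (hV : V ∈ unitaryGroup (Fin n) ℂ) {Q : Matrix (Fin n) (Fin n) ℂ}
    (hQ : Q ∈ feasibleSet n) (hdiag : (Vᴴ * Q * V).IsDiag) :
    ∃ ζ ∈ stdSimplex ℝ (Fin n), Q = conjDiag V ζ := by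
  have hV' : Vᴴ ∈ unitaryGroup (Fin n) ℂ := Unitary.star_mem hV
  have hVV : V * Vᴴ = 1 := mem_unitaryGroup_iff.1 hV
  have hA := mem_feasibleSet_unitary hQ hV'
  rw [conjTranspose_conjTranspose] at hA
  set A := Vᴴ * Q * V with hAdef
  have hreal : ∀ i, ((A i i).re : ℂ) = A i i := fun i => hA.1.isHermitian.coe_re_apply_self i
  refine ⟨fun i => (A i i).re, ⟨fun i => (Complex.le_def.1 (hA.1.diag_nonneg (i := i))).1, ?_⟩, ?_⟩
  · have h := congrArg Complex.re hA.2
    simpa [trace] using h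
  · have h : diagonal (fun i => (((A i i).re : ℝ) : ℂ)) = A := by
      simp_rw [hreal]
      exact (isDiag_iff_diagonal_diag A).1 hdiag
    rw [conjDiag, h, hAdef]
    calc Q = (V * Vᴴ) * Q * (V * Vᴴ) := by rw [hVV, Matrix.one_mul, Matrix.mul_one]
      _ = _ := by simp only [Matrix.mul_assoc]

end Optimality

end MISOWiretap

/-! ### Assembly of the theorem. -/

theorem mainTheorem3 (n : ℕ) (hn : 0 < n) (ρ : ℝ) (hρ : 0 < ρ) (α : ℝ) (hα : 0 < α)
    (SR SE : Matrix (Fin n) (Fin n) ℂ) (hSR : SR.PosDef)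
    (hSE : SE = (α : ℂ) • (1 : Matrix (Fin n) (Fin n) ℂ))
    (V : Matrix (Fin n) (Fin n) ℂ) (hV : V ∈ Matrix.unitaryGroup (Fin n) ℂ)
    (η : Fin n → ℝ) (hdist : Function.Injective η)
    (hdecomp : SR = MISOWiretap.conjDiag V η) :
    -- the expectations in the secrecy rate are finite
    (∀ Q ∈ MISOWiretap.feasibleSet n,
      MeasureTheory.Integrable (MISOWiretap.logRate ρ Q) (MISOWiretap.complexGaussian SR) ∧
      MeasureTheory.Integrable (MISOWiretap.logRate ρ Q) (MISOWiretap.complexGaussian SE)) ∧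
    -- every optimal input covariance is diagonalized by the eigenvectors of `SR`
    (∀ Q, MISOWiretap.IsOptimalInput ρ SR SE Q → (Vᴴ * Q * V).IsDiag) ∧
    -- the secrecy rate of a diagonalized input is the objective of the power allocation problem
    (∀ ζ ∈ stdSimplex ℝ (Fin n),
      MeasureTheory.Integrable (MISOWiretap.logAllocRate ρ (fun i => η i * ζ i))
        (MISOWiretap.stdComplexGaussianVec n) ∧
      MeasureTheory.Integrable (MISOWiretap.logAllocRate (α * ρ) ζ)
        (MISOWiretap.stdComplexGaussianVec n) ∧
      MISOWiretap.conjDiag V ζ ∈ MISOWiretap.feasibleSet n ∧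
      MISOWiretap.ergodicSecrecyRate ρ SR SE (MISOWiretap.conjDiag V ζ) =
        MISOWiretap.allocationRate ρ α η ζ) ∧
    -- the optimal inputs are exactly those given by the optimal power allocations
    (∀ Q, MISOWiretap.IsOptimalInput ρ SR SE Q ↔
      ∃ ζ, MISOWiretap.IsOptimalAllocation ρ α η ζ ∧ Q = MISOWiretap.conjDiag V ζ) ∧
    -- both problems attain their maximum, and the maximal values agree
    (∃ C : ℝ,
      IsGreatest (MISOWiretap.ergodicSecrecyRate ρ SR SE '' MISOWiretap.feasibleSet n) C ∧
      IsGreatest (MISOWiretap.allocationRate ρ α η '' stdSimplex ℝ (Fin n)) C) := by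
  open MISOWiretap in
  subst hSE hdecomp
  have hη : ∀ i, 0 < η i := eigenvalue_pos hV hSR
  have hη0 : ∀ i, 0 ≤ η i := fun i => (hη i).le
  have hrate : ∀ ζ, ergodicSecrecyRate ρ (conjDiag V η) ((α : ℂ) • 1) (conjDiag V ζ) =
      allocationRate ρ α η ζ := ergodicSecrecyRate_conjDiag hα.le hV hη0
  have hopt : ∀ Q, IsOptimalInput ρ (conjDiag V η) ((α : ℂ) • 1) Q →
      ∃ ζ, IsOptimalAllocation ρ α η ζ ∧ Q = conjDiag V ζ := by
    intro Q hQ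
    obtain ⟨ζ, hζ, rfl⟩ := exists_eq_conjDiag hV hQ.1
      (isDiag_of_isOptimalInput hρ hα hV hη hdist hQ)
    refine ⟨ζ, ⟨hζ, isMaxOn_iff.2 fun ξ hξ => ?_⟩, rfl⟩
    have h := isMaxOn_iff.1 hQ.2 _ (conjDiag_mem_feasibleSet hV hξ)
    rwa [hrate, hrate] at h
  -- One optimal `Q₀` also produces an optimal allocation `ζ₀` with the same value; every other
  -- maximizer is compared with this pair.
  obtain ⟨Q₀, hQ₀⟩ := exists_isOptimalInput hn hρ.le hα.le hV hη0
  obtain ⟨ζ₀, hζ₀, hQζ⟩ := hopt Q₀ hQ₀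
  refine ⟨fun Q hQ => ⟨integrable_logRate_complexGaussian hρ.le _ hQ.1,
      integrable_logRate_complexGaussian hρ.le _ hQ.1⟩,
    fun Q hQ => isDiag_of_isOptimalInput hρ hα hV hη hdist hQ,
    fun ζ hζ => ⟨?_, ?_, conjDiag_mem_feasibleSet hV hζ, hrate ζ⟩,
    fun Q => ⟨hopt Q, ?_⟩,
    ergodicSecrecyRate ρ (conjDiag V η) ((α : ℂ) • 1) Q₀, ⟨⟨Q₀, hQ₀.1, rfl⟩, ?_⟩,
    ⟨⟨ζ₀, hζ₀.1, by rw [hQζ, hrate]⟩, ?_⟩⟩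
  · rw [← logRate_diagonal]
    exact integrable_logRate hρ.le
      (posSemidef_diagonal_ofReal fun i => mul_nonneg (hη0 i) (hζ.1 i))
  · rw [← logRate_diagonal]
    exact integrable_logRate (mul_pos hα hρ).le (posSemidef_diagonal_ofReal hζ.1)
  · rintro ⟨ζ, hζ, rfl⟩
    refine ⟨conjDiag_mem_feasibleSet hV hζ.1, isMaxOn_iff.2 fun Q hQ =>
      (isMaxOn_iff.1 hQ₀.2 Q hQ).trans ?_⟩
    rw [hQζ, hrate, hrate]
    exact isMaxOn_iff.1 hζ.2 _ hζ₀.1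
  · rintro _ ⟨Q, hQ, rfl⟩
    exact isMaxOn_iff.1 hQ₀.2 Q hQ
  · rintro _ ⟨ζ, hζ, rfl⟩
    rw [hQζ, hrate]
    exact isMaxOn_iff.1 hζ₀.2 ζ hζ
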